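/- For $a\in\mathbb{R}$ and $b>0$ let $\mathrm{AL}(0,a,b)$ be the asymmetric Laplace distribution, with density \[f(x)=\frac{1}{\sqrt{2b^2+a^2}}\exp\Big(\frac{a}{b^2}x-\frac1b\sqrt{2+\frac{a^2}{b^2}}\,|x|\Big),\quad x\in\mathbb{R}.\] For real random variables $X,Y$ let $d_{\mathrm K}(X,Y)=\sup_{z\in\mathbb{R}}|\mathbb{P}(X\le z)-\mathbb{P}(Y\le z)|$ be the Kolmogorov distance and $d_{\mathrm W}(X,Y)=\sup_h|\mathbb{E}h(X)-\mathbb{E}h(Y)|$ the Wasserstein distance, the latter supremum being over all $h:\mathbb{R}\to\mathbb{R}$ that are Lipschitz with constant at most $1$. **Theorem.** Let $a\in\mathbb{R}$, $b>0$, $\tau\ge0$, let $Z'\sim\mathrm{AL}(0,a,b)$, and let $\eta$ be a random variable independent of $Z'$ with mean zero and finite variance $\tau^2$. Let $W=Z'+\eta$ and $Z\sim\mathrm{AL}(0,a,\sqrt{b^2+\tau^2})$, and put \[c=\frac{14}{\sqrt{a^2+2b^2+2\tau^2}}+\frac{7|a|}{b^2+\tau^2},\qquad d=5+\frac{7|a|}{\sqrt{a^2+2b^2+2\tau^2}}.\]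 (i) Then \[d_{\mathrm K}(W,Z)\le1.05\left(\frac{b^2c^2d\tau^2}{b^2+\tau^2}\right)^{1/3}+\frac{d\tau^2}{b^2+\tau^2},\qquad d_{\mathrm W}(W,Z)\le\tau+\frac{\tau^2}{\sqrt{2b^2+a^2}}.\] (ii) If, in addition, for some real $n\ge2$ and some $C>0$ we have $\mathbb{P}(|\eta|>s)\le C\tau^n/s^n$ for all $s>0$, then \[d_{\mathrm K}(W,Z)\le2\left(\frac{2b^2c^nCd\tau^n}{(b^2+\tau^2)(n^2+3n+2)}\right)^{1/(n+1)}+\frac{d\tau^2}{b^2+\tau^2}.\] (iii) If $0<\tau<1$ and $\eta\sim\mathrm{N}(0,\tau^2)$, then \[d_{\mathrm K}(W,Z)\le\left(2c+\frac{b^2d}{2\sqrt{2\pi}\,(b^2+\tau^2)\log(1/\tau)}\right)\tau\sqrt{\log(1/\tau)}+\frac{d\tau^2}{b^2+\tau^2},\] \[d_{\mathrm W}(W,Z)\le\sqrt{\frac{2}{\pi}}\,\tau+\frac{\tau^2}{\sqrt{2b^2+a^2}}.\] -/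

import Mathlib

open MeasureTheory ProbabilityTheory
open scoped ENNReal NNReal

noncomputable section

/-- The density of the asymmetric Laplace distribution with location `m`, asymmetry `a` and
scale `b > 0`. -/
def alPDF (m a b : ℝ) (x : ℝ) : ℝ :=
  1 / √(2 * b ^ 2 + a ^ 2) *
    Real.exp (a / b ^ 2 * (x - m) - 1 / b * √(2 + a ^ 2 / b ^ 2) * |x - m|)

/-- The asymmetric Laplace distribution `AL(m, a, b)` on the real line. -/
def alMeasure (m a b : ℝ) : Measure ℝ :=
  volume.withDensity (fun x => ENNReal.ofReal (alPDF m a b x))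

/-- The integral probability metric `sup_{h ∈ H} |E h(X) - E h(Y)|` between the law `μ` of `X`
and the law `ν` of `Y`, with values in `[0, ∞]`; it is meant for classes `H` of functions that
are integrable for both laws. -/
def integralProbMetric (H : Set (ℝ → ℝ)) (μ ν : Measure ℝ) : ℝ≥0∞ :=
  ⨆ h ∈ H, ENNReal.ofReal |∫ x, h x ∂μ - ∫ x, h x ∂ν|

/-- Indicator functions of the half-lines `(-∞, z]`. -/
def kolmogorovClass : Set (ℝ → ℝ) :=
  {h | ∃ z : ℝ, h = Set.indicator (Set.Iic z) (fun _ => (1 : ℝ))}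

/-- Lipschitz functions with Lipschitz constant at most one. -/
def wassersteinClass : Set (ℝ → ℝ) :=
  {h | LipschitzWith 1 h}

/-- The Kolmogorov distance between two laws on the real line. -/
def dK (μ ν : Measure ℝ) : ℝ≥0∞ := integralProbMetric kolmogorovClass μ ν

/-- The Wasserstein distance between two laws on the real line. -/
def dW (μ ν : Measure ℝ) : ℝ≥0∞ := integralProbMetric wassersteinClass μ ν

end

/-! Write S = √(2b²+a²), S' = √(2(b²+τ²)+a²). Both distances go through Z' by the triangle
inequality, and everything rests on the explicit form of the law: with p = (S+a)/2 and q = (S-a)/2,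
the density is S⁻¹e^{-x/p} on the right and S⁻¹e^{x/q} on the left.

Kolmogorov: the density is at most 1/S, so conditioning on η gives |P(W ≤ z) - P(Z' ≤ z)| ≤ E min(1,
|η|/S) (`abs_real_map_add_Iic_sub_le`). The law of Z dominates S/S' times the law of Z', so these
two differ by at most 1 - S/S' ≤ τ²/(b²+τ²) on every event (`abs_real_alMeasure_sub_sqrt_le`). As
E|η| ≤ τ, the error is linear in τ, and the stated bounds follow by comparing constants. If 4τ² ≥
b², the term dτ²/(b²+τ²) already exceeds 1; otherwise c ≥ 12/S and b²d/(b²+τ²) ≥ 4, which leaves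
ample room.

Wasserstein: W and Z' are coupled at cost E|η|. Z' and Z are compared through a common exponential
variable at cost S' - S ≤ τ²/S (`abs_integral_alMeasure_sub_le`). -/

/-! ### The density as two exponential branches -/

/-- The mean of the positive part of the mixture of exponential distributions that constitutes
`AL(0, a, b)`; the mean of the negative part is `alScale (-a) b`. -/
noncomputable def alScale (a b : ℝ) : ℝ := (√(2 * b ^ 2 + a ^ 2) + a) / 2

lemma alScale_add_alScale_neg (a b : ℝ) :
    alScale a b + alScale (-a) b = √(2 * b ^ 2 + a ^ 2) := by
  simp only [alScale, neg_sq]; ring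

lemma abs_lt_sqrt_two_mul_sq_add_sq (a : ℝ) {b : ℝ} (hb : 0 < b) :
    |a| < √(2 * b ^ 2 + a ^ 2) := by
  apply Real.lt_sqrt_of_sq_lt
  rw [sq_abs]
  nlinarith [pow_pos hb 2]

lemma sqrt_two_mul_sq_add_sq_pos (a : ℝ) {b : ℝ} (hb : 0 < b) : 0 < √(2 * b ^ 2 + a ^ 2) :=
  (abs_nonneg a).trans_lt (abs_lt_sqrt_two_mul_sq_add_sq a hb)

lemma sq_sqrt_two_mul_sq_add_sq (a b : ℝ) : √(2 * b ^ 2 + a ^ 2) ^ 2 = 2 * b ^ 2 + a ^ 2 :=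
  Real.sq_sqrt (by positivity)

lemma alScale_pos (a : ℝ) {b : ℝ} (hb : 0 < b) : 0 < alScale a b := by
  have h := (abs_lt.1 (abs_lt_sqrt_two_mul_sq_add_sq a hb)).1
  simp only [alScale]
  linarith

/-- Since (S-a)(S+a) = 2b², the decay rate (S-a)/b² equals 2/(S+a). The left branch follows by
reflection, which replaces a by -a. -/
lemma alPDF_zero_of_nonneg (a : ℝ) {b : ℝ} (hb : 0 < b) {x : ℝ} (hx : 0 ≤ x) :
    alPDF 0 a b x = (√(2 * b ^ 2 + a ^ 2))⁻¹ * Real.exp (-(x / alScale a b)) := by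
  have hS : √(2 + a ^ 2 / b ^ 2) = √(2 * b ^ 2 + a ^ 2) / b := by
    rw [show 2 + a ^ 2 / b ^ 2 = (2 * b ^ 2 + a ^ 2) / b ^ 2 by field_simp,
      Real.sqrt_div (by positivity), Real.sqrt_sq hb.le]
  have hp := alScale_pos a hb
  rw [alPDF, sub_zero, abs_of_nonneg hx, hS, one_div]
  congr 2
  have hsq := sq_sqrt_two_mul_sq_add_sq a b
  unfold alScale at hp ⊢
  have hp' : √(2 * b ^ 2 + a ^ 2) + a ≠ 0 := by linarith
  generalize √(2 * b ^ 2 + a ^ 2) = S at *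
  field_simp
  linear_combination (-x) * hsq

lemma alPDF_zero_neg (a b x : ℝ) : alPDF 0 a b (-x) = alPDF 0 (-a) b x := by
  simp only [alPDF, sub_zero, abs_neg, neg_sq]
  congr 2
  ring

lemma alPDF_nonneg (m a b x : ℝ) : 0 ≤ alPDF m a b x := by
  unfold alPDF; positivity

@[fun_prop]
lemma continuous_alPDF (m a b : ℝ) : Continuous (alPDF m a b) := by
  unfold alPDF; fun_prop

lemma alPDF_zero_le (a : ℝ) {b : ℝ} (hb : 0 < b) (x : ℝ) :
    alPDF 0 a b x ≤ (√(2 * b ^ 2 + a ^ 2))⁻¹ := by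
  have key : ∀ a x : ℝ, 0 ≤ x → alPDF 0 a b x ≤ (√(2 * b ^ 2 + a ^ 2))⁻¹ := by
    intro a x hx
    rw [alPDF_zero_of_nonneg a hb hx]
    refine mul_le_of_le_one_right (by positivity) (Real.exp_le_one_iff.2 ?_)
    have := div_nonneg hx (alScale_pos a hb).le
    linarith
  rcases le_total 0 x with hx | hx
  · exact key a x hx
  · have := key (-a) (-x) (by linarith)
    rwa [alPDF_zero_neg, neg_neg, neg_sq] at this

lemma sqrt_two_mul_sq_add_sq_mono (a : ℝ) {b b' : ℝ} (hb : 0 < b) (h : b ≤ b') :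
    √(2 * b ^ 2 + a ^ 2) ≤ √(2 * b' ^ 2 + a ^ 2) := by
  gcongr

/-- Without the prefactor only e^{-x/p} or e^{x/q} remains, and both scales p and q increase with b.
-/
lemma sqrt_mul_alPDF_zero_mono (a : ℝ) {b b' : ℝ} (hb : 0 < b) (h : b ≤ b') (x : ℝ) :
    √(2 * b ^ 2 + a ^ 2) * alPDF 0 a b x ≤ √(2 * b' ^ 2 + a ^ 2) * alPDF 0 a b' x := by
  have hb' : 0 < b' := hb.trans_le h
  have key : ∀ a x : ℝ, 0 ≤ x →
      √(2 * b ^ 2 + a ^ 2) * alPDF 0 a b x ≤ √(2 * b' ^ 2 + a ^ 2) * alPDF 0 a b' x := by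
    intro a x hx
    rw [alPDF_zero_of_nonneg a hb hx, alPDF_zero_of_nonneg a hb' hx,
      mul_inv_cancel_left₀ (sqrt_two_mul_sq_add_sq_pos a hb).ne',
      mul_inv_cancel_left₀ (sqrt_two_mul_sq_add_sq_pos a hb').ne']
    have hp := alScale_pos a hb
    gcongr
    unfold alScale
    linarith [sqrt_two_mul_sq_add_sq_mono a hb h]
  rcases le_total 0 x with hx | hx
  · exact key a x hx
  · have := key (-a) (-x) (by linarith)
    rwa [alPDF_zero_neg, alPDF_zero_neg, neg_neg, neg_sq] at this

/-! ### Integrals against the law as exponential mixtures -/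

lemma integrableOn_exp_neg_div_mul {r : ℝ} (hr : 0 < r) {g : ℝ → ℝ}
    (hg : IntegrableOn (fun t => Real.exp (-t) * g (r * t)) (Set.Ioi 0)) :
    IntegrableOn (fun x => Real.exp (-(x / r)) * g x) (Set.Ioi 0) := by
  have := integrableOn_Ioi_comp_mul_left_iff (fun x => Real.exp (-(x / r)) * g x) 0 hr
  simp only [mul_div_cancel_left₀ _ hr.ne', mul_zero] at this
  exact this.1 hg

lemma setIntegral_exp_neg_div_mul {r : ℝ} (hr : 0 < r) (g : ℝ → ℝ) :
    ∫ x in Set.Ioi 0, Real.exp (-(x / r)) * g x =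
      r * ∫ t in Set.Ioi 0, Real.exp (-t) * g (r * t) := by
  have := integral_comp_mul_left_Ioi (fun x => Real.exp (-(x / r)) * g x) 0 hr
  simp only [mul_div_cancel_left₀ _ hr.ne', mul_zero, smul_eq_mul] at this
  rw [this, mul_inv_cancel_left₀ hr.ne']

/-- `AL(0, a, b)` is a mixture of an exponential and a reflected exponential distribution. -/
lemma integral_alMeasure (a : ℝ) {b : ℝ} (hb : 0 < b) {g : ℝ → ℝ}
    (h₁ : IntegrableOn (fun t => Real.exp (-t) * g (alScale a b * t)) (Set.Ioi 0))
    (h₂ : IntegrableOn (fun t => Real.exp (-t) * g (-(alScale (-a) b * t))) (Set.Ioi 0)) :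
    Integrable g (alMeasure 0 a b) ∧
      ∫ x, g x ∂alMeasure 0 a b = (√(2 * b ^ 2 + a ^ 2))⁻¹ *
        (alScale a b * (∫ t in Set.Ioi 0, Real.exp (-t) * g (alScale a b * t)) +
          alScale (-a) b * ∫ t in Set.Ioi 0, Real.exp (-t) * g (-(alScale (-a) b * t))) := by
  have hp := alScale_pos a hb
  have hq := alScale_pos (-a) hb
  have hm : Measurable (fun x => ENNReal.ofReal (alPDF 0 a b x)) :=
    (continuous_alPDF 0 a b).measurable.ennreal_ofReal
  have hfin : ∀ᵐ x : ℝ, ENNReal.ofReal (alPDF 0 a b x) < ∞ := by simp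
  have e₁ : Set.EqOn (fun x => alPDF 0 a b x * g x)
      (fun x => (√(2 * b ^ 2 + a ^ 2))⁻¹ * (Real.exp (-(x / alScale a b)) * g x))
      (Set.Ioi 0) := by
    intro x hx
    simp only [alPDF_zero_of_nonneg a hb (le_of_lt hx), mul_assoc]
  have e₂ : Set.EqOn (fun x => alPDF 0 a b (-x) * g (-x))
      (fun x => (√(2 * b ^ 2 + a ^ 2))⁻¹ * (Real.exp (-(x / alScale (-a) b)) * g (-x)))
      (Set.Ioi 0) := by
    intro x hx
    simp only [alPDF_zero_neg, alPDF_zero_of_nonneg (-a) hb (le_of_lt hx), neg_sq, mul_assoc]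
  have i₁ : IntegrableOn (fun x => alPDF 0 a b x * g x) (Set.Ioi 0) :=
    IntegrableOn.congr_fun ((integrableOn_exp_neg_div_mul hp h₁).const_mul _) e₁.symm
      measurableSet_Ioi
  have i₂' : IntegrableOn (fun x => alPDF 0 a b (-x) * g (-x)) (Set.Ioi 0) :=
    IntegrableOn.congr_fun
      ((integrableOn_exp_neg_div_mul (g := fun x => g (-x)) hq h₂).const_mul _) e₂.symm
      measurableSet_Ioi
  have i₂ : IntegrableOn (fun x => alPDF 0 a b x * g x) (Set.Iic 0) := by
    have := i₂'.comp_neg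
    simp only [neg_neg, Set.neg_Ioi, neg_zero] at this
    exact (integrableOn_Iic_iff_integrableOn_Iio (by finiteness)).2 this
  constructor
  · unfold alMeasure
    rw [integrable_withDensity_iff_integrable_smul' hm hfin]
    simp only [ENNReal.toReal_ofReal (alPDF_nonneg _ _ _ _), smul_eq_mul]
    rw [← integrableOn_univ, ← Set.Iic_union_Ioi (a := (0 : ℝ))]
    exact i₂.union i₁
  · unfold alMeasure
    rw [integral_withDensity_eq_integral_toReal_smul hm hfin]
    simp only [ENNReal.toReal_ofReal (alPDF_nonneg _ _ _ _), smul_eq_mul]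
    have h0 := integral_comp_neg_Ioi 0 (fun x => alPDF 0 a b x * g x)
    rw [neg_zero] at h0
    rw [← intervalIntegral.integral_Iic_add_Ioi i₂ i₁, ← h0,
      setIntegral_congr_fun measurableSet_Ioi e₁, setIntegral_congr_fun measurableSet_Ioi e₂,
      integral_const_mul, integral_const_mul, setIntegral_exp_neg_div_mul hp,
      setIntegral_exp_neg_div_mul hq (fun x => g (-x))]
    ring

lemma integrableOn_exp_neg_Ioi_zero : IntegrableOn (fun t : ℝ => Real.exp (-t)) (Set.Ioi 0) :=
  integrableOn_exp_neg_Ioi 0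

lemma integrableOn_exp_neg_mul_self_Ioi_zero :
    IntegrableOn (fun t : ℝ => Real.exp (-t) * t) (Set.Ioi 0) := by
  simpa [show (2 : ℝ) - 1 = 1 by norm_num] using Real.GammaIntegral_convergent (s := 2) (by norm_num)

lemma integral_exp_neg_mul_self_Ioi_zero : ∫ t in Set.Ioi (0 : ℝ), Real.exp (-t) * t = 1 := by
  have := Real.Gamma_eq_integral (s := 2) (by norm_num)
  simpa [show (2 : ℝ) - 1 = 1 by norm_num, Real.Gamma_two] using this.symm

lemma isProbabilityMeasure_alMeasure (a : ℝ) {b : ℝ} (hb : 0 < b) :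
    IsProbabilityMeasure (alMeasure 0 a b) := by
  have hi : IntegrableOn (fun t : ℝ => Real.exp (-t) * 1) (Set.Ioi 0) := by
    simpa using integrableOn_exp_neg_Ioi_zero
  have := (integral_alMeasure a hb (g := fun _ => (1 : ℝ)) hi hi).2
  simp only [mul_one, integral_exp_neg_Ioi_zero, alScale_add_alScale_neg,
    inv_mul_cancel₀ (sqrt_two_mul_sq_add_sq_pos a hb).ne', integral_const, smul_eq_mul] at this
  constructor
  rw [Measure.real, ENNReal.toReal_eq_one_iff] at this
  exact this

lemma integrableOn_exp_neg_mul_lipschitz {g : ℝ → ℝ} (hg : LipschitzWith 1 g) (r : ℝ) :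
    IntegrableOn (fun t => Real.exp (-t) * g (r * t)) (Set.Ioi 0) := by
  have hc := hg.continuous
  have hdom : IntegrableOn (fun t : ℝ => Real.exp (-t) * |g 0| + |r| * (Real.exp (-t) * t))
      (Set.Ioi 0) :=
    (integrableOn_exp_neg_Ioi_zero.mul_const _).add
      (integrableOn_exp_neg_mul_self_Ioi_zero.const_mul _)
  refine Integrable.mono' hdom (by fun_prop) ?_
  filter_upwards [ae_restrict_mem measurableSet_Ioi] with t ht
  have h1 := hg.dist_le_mul (r * t) 0
  rw [Real.dist_eq, Real.dist_eq, NNReal.coe_one, one_mul, sub_zero, abs_mul,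
    abs_of_pos (show 0 < t from ht)] at h1
  have h2 : |g (r * t)| ≤ |g 0| + |r| * t := by
    have := abs_sub_abs_le_abs_sub (g (r * t)) (g 0)
    linarith
  rw [Real.norm_eq_abs, abs_mul, abs_of_pos (Real.exp_pos _)]
  nlinarith [Real.exp_pos (-t)]

lemma integrable_alMeasure_of_lipschitz (a : ℝ) {b : ℝ} (hb : 0 < b) {g : ℝ → ℝ}
    (hg : LipschitzWith 1 g) : Integrable g (alMeasure 0 a b) := by
  refine (integral_alMeasure a hb (integrableOn_exp_neg_mul_lipschitz hg _) ?_).1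
  simpa using integrableOn_exp_neg_mul_lipschitz hg (-(alScale (-a) b))

/-! ### Changing the scale b -/

/-- Two two-point mixtures of Lipschitz functions with equal mean `p - q = p' - q'`. -/
lemma abs_mixture_sub_mixture_le {g : ℝ → ℝ} (hg : LipschitzWith 1 g) {p q δ t : ℝ}
    (hp : 0 < p) (hq : 0 < q) (hδ : 0 ≤ δ) (ht : 0 ≤ t) :
    |(p * g (p * t) + q * g (-(q * t))) / (p + q) -
      ((p + δ) * g ((p + δ) * t) + (q + δ) * g (-((q + δ) * t))) / (p + δ + (q + δ))| ≤
      2 * δ * t := by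
  have lip : ∀ x y, |g x - g y| ≤ |x - y| := fun x y => by
    simpa [Real.dist_eq] using hg.dist_le_mul x y
  have hS : 0 < p + q := by positivity
  have hS' : 0 < p + δ + (q + δ) := by positivity
  -- Move the two points under the new weights, then transfer between the old points the mass by
  -- which the weights differ; that mass is proportional to (p-q)δ.
  have e : (p * g (p * t) + q * g (-(q * t))) / (p + q) -
      ((p + δ) * g ((p + δ) * t) + (q + δ) * g (-((q + δ) * t))) / (p + δ + (q + δ)) =
      (p + δ) / (p + δ + (q + δ)) * (g (p * t) - g ((p + δ) * t)) +
      (q + δ) / (p + δ + (q + δ)) * (g (-(q * t)) - g (-((q + δ) * t))) +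
      (p - q) * δ / ((p + q) * (p + δ + (q + δ))) * (g (p * t) - g (-(q * t))) := by
    field_simp
    ring
  have b₁ : |g (p * t) - g ((p + δ) * t)| ≤ δ * t := by
    refine (lip _ _).trans_eq ?_
    rw [show p * t - (p + δ) * t = -(δ * t) by ring, abs_neg, abs_of_nonneg (by positivity)]
  have b₂ : |g (-(q * t)) - g (-((q + δ) * t))| ≤ δ * t := by
    refine (lip _ _).trans_eq ?_
    rw [show -(q * t) - -((q + δ) * t) = δ * t by ring, abs_of_nonneg (by positivity)]
  have b₃ : |g (p * t) - g (-(q * t))| ≤ (p + q) * t := by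
    refine (lip _ _).trans_eq ?_
    rw [show p * t - -(q * t) = (p + q) * t by ring, abs_of_nonneg (by positivity)]
  have b₄ : |(p - q) * δ / ((p + q) * (p + δ + (q + δ)))| ≤ δ / (p + q) := by
    rw [abs_div, abs_mul, abs_of_nonneg hδ, abs_of_pos (mul_pos hS hS'),
      div_le_div_iff₀ (mul_pos hS hS') hS]
    have : |p - q| ≤ p + δ + (q + δ) := abs_le.2 ⟨by linarith, by linarith⟩
    calc |p - q| * δ * (p + q) ≤ (p + δ + (q + δ)) * δ * (p + q) := by gcongr
      _ = _ := by ring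
  rw [e]
  calc _ ≤ (p + δ) / (p + δ + (q + δ)) * (δ * t) + (q + δ) / (p + δ + (q + δ)) * (δ * t) +
        δ / (p + q) * ((p + q) * t) := by
        refine (abs_add_three _ _ _).trans ?_
        rw [abs_mul, abs_mul, abs_mul, abs_of_nonneg (a := (p + δ) / _) (by positivity),
          abs_of_nonneg (a := (q + δ) / _) (by positivity)]
        gcongr
    _ = 2 * δ * t := by
      field_simp
      ring

/-- As p - q = a does not depend on b, both scales grow by the same δ = (S'-S)/2. Using one
exponential variable t for both laws, the pointwise bound 2δt integrates to 2δ. -/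
lemma abs_integral_alMeasure_sub_le (a : ℝ) {b b' : ℝ} (hb : 0 < b) (h : b ≤ b') {g : ℝ → ℝ}
    (hg : LipschitzWith 1 g) :
    |∫ x, g x ∂alMeasure 0 a b - ∫ x, g x ∂alMeasure 0 a b'| ≤
      √(2 * b' ^ 2 + a ^ 2) - √(2 * b ^ 2 + a ^ 2) := by
  have hb' : 0 < b' := hb.trans_le h
  have i : ∀ r, IntegrableOn (fun t => Real.exp (-t) * g (r * t)) (Set.Ioi 0) :=
    integrableOn_exp_neg_mul_lipschitz hg
  have j : ∀ r, IntegrableOn (fun t => Real.exp (-t) * g (-(r * t))) (Set.Ioi 0) := fun r => by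
    simpa using i (-r)
  rw [(integral_alMeasure a hb (i _) (j _)).2, (integral_alMeasure a hb' (i _) (j _)).2]
  set δ := (√(2 * b' ^ 2 + a ^ 2) - √(2 * b ^ 2 + a ^ 2)) / 2 with hδ
  have hδ0 : 0 ≤ δ := by linarith [sqrt_two_mul_sq_add_sq_mono a hb h]
  have e₁ : alScale a b' = alScale a b + δ := by simp only [alScale, hδ]; ring
  have e₂ : alScale (-a) b' = alScale (-a) b + δ := by simp only [alScale, hδ, neg_sq]; ring
  rw [← alScale_add_alScale_neg a b, ← alScale_add_alScale_neg a b', e₁, e₂]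
  have hp := alScale_pos a hb
  have hq := alScale_pos (-a) hb
  generalize alScale a b = p at *
  generalize alScale (-a) b = q at *
  have key : ∀ p q : ℝ, (p + q)⁻¹ * (p * (∫ t in Set.Ioi 0, Real.exp (-t) * g (p * t)) +
      q * ∫ t in Set.Ioi 0, Real.exp (-t) * g (-(q * t))) =
      ∫ t in Set.Ioi 0, Real.exp (-t) * ((p * g (p * t) + q * g (-(q * t))) / (p + q)) ∧
      IntegrableOn (fun t => Real.exp (-t) * ((p * g (p * t) + q * g (-(q * t))) / (p + q)))
        (Set.Ioi 0) := by
    intro p q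
    have e : ∀ t, Real.exp (-t) * ((p * g (p * t) + q * g (-(q * t))) / (p + q)) =
        (p + q)⁻¹ * (p * (Real.exp (-t) * g (p * t)) + q * (Real.exp (-t) * g (-(q * t)))) := by
      intro t; rw [div_eq_inv_mul]; ring
    simp only [e]
    refine ⟨?_, (((i p).const_mul p).add ((j q).const_mul q)).const_mul _⟩
    rw [integral_const_mul, integral_add ((i p).const_mul p) ((j q).const_mul q),
      integral_const_mul, integral_const_mul]
  rw [(key _ _).1, (key _ _).1, ← integral_sub (key _ _).2 (key _ _).2]
  have hint : ∫ t in Set.Ioi (0 : ℝ), 2 * δ * (Real.exp (-t) * t) = 2 * δ := by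
    rw [integral_const_mul, integral_exp_neg_mul_self_Ioi_zero, mul_one]
  have : p + δ + (q + δ) - (p + q) = 2 * δ := by ring
  rw [this, ← hint, ← Real.norm_eq_abs]
  refine norm_integral_le_of_norm_le (integrableOn_exp_neg_mul_self_Ioi_zero.const_mul _) ?_
  filter_upwards [ae_restrict_mem measurableSet_Ioi] with t ht
  rw [← mul_sub, Real.norm_eq_abs, abs_mul, abs_of_pos (Real.exp_pos _)]
  have := abs_mixture_sub_mixture_le hg hp hq hδ0 (le_of_lt ht)
  nlinarith [Real.exp_pos (-t)]

/-- (S'-S)(S'+S) = 2τ² and S'+S ≥ 2S. -/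
lemma sqrt_two_mul_sq_add_sq_sub_le (a : ℝ) {b τ : ℝ} (hb : 0 < b) :
    √(2 * √(b ^ 2 + τ ^ 2) ^ 2 + a ^ 2) - √(2 * b ^ 2 + a ^ 2) ≤
      τ ^ 2 / √(2 * b ^ 2 + a ^ 2) := by
  have hS := sqrt_two_mul_sq_add_sq_pos a hb
  have h := sqrt_two_mul_sq_add_sq_mono a hb (Real.le_sqrt_of_sq_le (x := b) (y := b ^ 2 + τ ^ 2)
    (by nlinarith [sq_nonneg τ]))
  have e₁ := sq_sqrt_two_mul_sq_add_sq a b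
  have e₂ := sq_sqrt_two_mul_sq_add_sq a (√(b ^ 2 + τ ^ 2))
  rw [Real.sq_sqrt (x := b ^ 2 + τ ^ 2) (by positivity)] at e₂ h ⊢
  rw [le_div_iff₀ hS]
  nlinarith

/-- Since `AL(0, a, b')` dominates a multiple of `AL(0, a, b)`, the two laws are close. -/
lemma abs_real_alMeasure_sub_le (a : ℝ) {b b' : ℝ} (hb : 0 < b) (h : b ≤ b') {A : Set ℝ}
    (hA : MeasurableSet A) :
    |(alMeasure 0 a b).real A - (alMeasure 0 a b').real A| ≤
      1 - √(2 * b ^ 2 + a ^ 2) / √(2 * b' ^ 2 + a ^ 2) := by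
  have hb' : 0 < b' := hb.trans_le h
  have := isProbabilityMeasure_alMeasure a hb
  have := isProbabilityMeasure_alMeasure a hb'
  have hS := sqrt_two_mul_sq_add_sq_pos a hb
  have hS' := sqrt_two_mul_sq_add_sq_pos a hb'
  have hSS := sqrt_two_mul_sq_add_sq_mono a hb h
  set k := √(2 * b ^ 2 + a ^ 2) / √(2 * b' ^ 2 + a ^ 2) with hk
  have hk0 : 0 ≤ k := by positivity
  have dom : ENNReal.ofReal k • alMeasure 0 a b ≤ alMeasure 0 a b' := by
    unfold alMeasure
    rw [← withDensity_smul _ (continuous_alPDF 0 a b).measurable.ennreal_ofReal]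
    refine withDensity_mono (Filter.Eventually.of_forall fun x => ?_)
    simp only [Pi.smul_apply, smul_eq_mul]
    rw [← ENNReal.ofReal_mul hk0]
    refine ENNReal.ofReal_le_ofReal ?_
    rw [hk, div_mul_eq_mul_div, div_le_iff₀ hS', mul_comm (alPDF _ _ _ _)]
    exact sqrt_mul_alPDF_zero_mono a hb h x
  have key : ∀ A : Set ℝ, (alMeasure 0 a b).real A - (alMeasure 0 a b').real A ≤ 1 - k := by
    intro A
    have h1 : k * (alMeasure 0 a b).real A ≤ (alMeasure 0 a b').real A := by
      have := ENNReal.toReal_mono (measure_ne_top _ A) (dom A)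
      simpa [Measure.real, ENNReal.toReal_ofReal hk0] using this
    have h2 : k ≤ 1 := (div_le_one hS').2 hSS
    have h3 : (alMeasure 0 a b).real A ≤ 1 := measureReal_le_one
    nlinarith
  refine abs_le.2 ⟨?_, key A⟩
  -- The reverse inequality is the one-sided bound on the complement.
  have := key Aᶜ
  rw [measureReal_compl hA, measureReal_compl hA, probReal_univ, probReal_univ] at this
  linarith

lemma abs_real_alMeasure_sub_sqrt_le (a : ℝ) {b τ : ℝ} (hb : 0 < b) {A : Set ℝ}
    (hA : MeasurableSet A) :
    |(alMeasure 0 a b).real A - (alMeasure 0 a (√(b ^ 2 + τ ^ 2))).real A| ≤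
      τ ^ 2 / (b ^ 2 + τ ^ 2) := by
  have hB : 0 < b ^ 2 + τ ^ 2 := by positivity
  have h : b ≤ √(b ^ 2 + τ ^ 2) := Real.le_sqrt_of_sq_le (by nlinarith [sq_nonneg τ])
  refine (abs_real_alMeasure_sub_le a hb h hA).trans ?_
  have hS := sqrt_two_mul_sq_add_sq_pos a hb
  have hSS := sqrt_two_mul_sq_add_sq_mono a hb h
  have e₁ := sq_sqrt_two_mul_sq_add_sq a b
  have e₂ := sq_sqrt_two_mul_sq_add_sq a (√(b ^ 2 + τ ^ 2))
  rw [Real.sq_sqrt hB.le] at e₂ hSS ⊢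
  have hS' := hS.trans_le hSS
  generalize √(2 * b ^ 2 + a ^ 2) = S at *
  generalize √(2 * (b ^ 2 + τ ^ 2) + a ^ 2) = S' at *
  rw [one_sub_div hS'.ne', div_le_div_iff₀ hS' hB]
  have h1 : 0 ≤ S' - S := by linarith
  -- This uses S'² ≥ 2(b²+τ²); together with (S'-S)(S'+S) = 2τ² it bounds (S'-S)/S'.
  have h2 : 2 * (b ^ 2 + τ ^ 2) ≤ S' * (S' + S) := by nlinarith [sq_nonneg a]
  have h3 : (S' - S) * (S' + S) = 2 * τ ^ 2 := by linarith [mul_self_nonneg S]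
  nlinarith

lemma real_alMeasure_Ioc_le (a : ℝ) {b : ℝ} (hb : 0 < b) {x y : ℝ} (h : x ≤ y) :
    (alMeasure 0 a b).real (Set.Ioc x y) ≤ (√(2 * b ^ 2 + a ^ 2))⁻¹ * (y - x) := by
  have hS := sqrt_two_mul_sq_add_sq_pos a hb
  refine ENNReal.toReal_le_of_le_ofReal (by have := sub_nonneg.2 h; positivity) ?_
  unfold alMeasure
  rw [withDensity_apply _ measurableSet_Ioc]
  calc _ ≤ ∫⁻ _ in Set.Ioc x y, ENNReal.ofReal (√(2 * b ^ 2 + a ^ 2))⁻¹ :=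
        lintegral_mono fun t => ENNReal.ofReal_le_ofReal (alPDF_zero_le a hb t)
    _ = _ := by
      rw [setLIntegral_const, Real.volume_Ioc, ENNReal.ofReal_mul (by positivity)]

/-! ### Reducing the distances to pointwise bounds -/

lemma dK_le_ofReal {μ ν : Measure ℝ} {r : ℝ}
    (h : ∀ z, |μ.real (Set.Iic z) - ν.real (Set.Iic z)| ≤ r) : dK μ ν ≤ ENNReal.ofReal r := by
  refine iSup₂_le ?_
  rintro _ ⟨z, rfl⟩
  rw [integral_indicator_const _ measurableSet_Iic, integral_indicator_const _ measurableSet_Iic,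
    smul_eq_mul, smul_eq_mul, mul_one, mul_one]
  exact ENNReal.ofReal_le_ofReal (h z)

lemma dW_le_ofReal {μ ν : Measure ℝ} {r : ℝ}
    (h : ∀ g : ℝ → ℝ, LipschitzWith 1 g → |∫ x, g x ∂μ - ∫ x, g x ∂ν| ≤ r) :
    dW μ ν ≤ ENNReal.ofReal r :=
  iSup₂_le fun g hg => ENNReal.ofReal_le_ofReal (h g hg)

lemma abs_measureReal_sub_measureReal_le_one {α : Type*} [MeasurableSpace α] (μ ν : Measure α)
    [IsProbabilityMeasure μ] [IsProbabilityMeasure ν] (A B : Set α) :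
    |μ.real A - ν.real B| ≤ 1 := by
  have h1 : μ.real A ≤ 1 := measureReal_le_one
  have h2 : ν.real B ≤ 1 := measureReal_le_one
  have h3 : 0 ≤ μ.real A := measureReal_nonneg
  have h4 : 0 ≤ ν.real B := measureReal_nonneg
  exact abs_le.2 ⟨by linarith, by linarith⟩

lemma abs_real_alMeasure_Iic_sub_le (a : ℝ) {b : ℝ} (hb : 0 < b) (x y : ℝ) :
    |(alMeasure 0 a b).real (Set.Iic x) - (alMeasure 0 a b).real (Set.Iic y)| ≤
      min 1 ((√(2 * b ^ 2 + a ^ 2))⁻¹ * |x - y|) := by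
  have := isProbabilityMeasure_alMeasure a hb
  refine le_min (abs_measureReal_sub_measureReal_le_one _ _ _ _) ?_
  · wlog h : y ≤ x generalizing x y
    · rw [abs_sub_comm, abs_sub_comm x]
      exact this y x (le_of_not_ge h)
    · have h1 := real_alMeasure_Ioc_le a hb h
      rw [show Set.Ioc y x = Set.Iic x \ Set.Iic y by ext t; simp [and_comm],
        measureReal_sdiff (Set.Iic_subset_Iic.2 h) measurableSet_Iic] at h1
      rwa [abs_of_nonneg (sub_nonneg.2 h), abs_of_nonneg (sub_nonneg.2
        (measureReal_mono (Set.Iic_subset_Iic.2 h)))]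

/-! ### The effect of adding η -/

section Perturbation

variable {Ω : Type*} [MeasurableSpace Ω] {P : Measure Ω} {Z' η : Ω → ℝ}

/-- Fubini on the product law of (Z', η): condition on η. -/
lemma real_map_add_Iic [IsProbabilityMeasure P] {μ : Measure ℝ} (hZ' : HasLaw Z' μ P)
    (hη : AEMeasurable η P)
    (hindep : IndepFun Z' η P) (z : ℝ) :
    Integrable (fun ω => μ.real (Set.Iic (z - η ω))) P ∧
      (P.map (fun ω => Z' ω + η ω)).real (Set.Iic z) =
        ∫ ω, μ.real (Set.Iic (z - η ω)) ∂P := by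
  have hμ : IsProbabilityMeasure μ := hZ'.map_eq ▸ Measure.isProbabilityMeasure_map hZ'.aemeasurable
  have hν : IsProbabilityMeasure (P.map η) := Measure.isProbabilityMeasure_map hη
  have hs : MeasurableSet {p : ℝ × ℝ | p.1 + p.2 ≤ z} :=
    measurableSet_le (by fun_prop) measurable_const
  have hpre : ∀ y, (fun x : ℝ => (x, y)) ⁻¹' {p : ℝ × ℝ | p.1 + p.2 ≤ z} = Set.Iic (z - y) := by
    intro y; ext x; simp [le_sub_iff_add_le]
  have hm : Measurable (fun y => μ (Set.Iic (z - y))) := by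
    simpa only [hpre] using measurable_measure_prodMk_right (μ := μ) hs
  have hint : Integrable (fun y => μ.real (Set.Iic (z - y))) (P.map η) :=
    Integrable.of_bound hm.ennreal_toReal.aestronglyMeasurable 1
      (Filter.Eventually.of_forall fun y => by
        rw [Real.norm_eq_abs, abs_of_nonneg measureReal_nonneg]
        exact measureReal_le_one)
  refine ⟨hint.comp_aemeasurable hη, ?_⟩
  rw [← integral_map hη hint.aestronglyMeasurable (f := fun y => μ.real (Set.Iic (z - y)))]
  simp only [Measure.real]
  rw [integral_toReal hm.aemeasurable (Filter.Eventually.of_forall fun y => measure_lt_top _ _)]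
  congr 1
  have e := (indepFun_iff_map_prod_eq_prod_map_map hZ'.aemeasurable hη).1 hindep
  rw [hZ'.map_eq] at e
  have e2 : P.map (fun ω => Z' ω + η ω) =
      (P.map (fun ω => (Z' ω, η ω))).map (fun p : ℝ × ℝ => p.1 + p.2) := by
    rw [AEMeasurable.map_map_of_aemeasurable (by fun_prop) (hZ'.aemeasurable.prodMk hη)]
    rfl
  rw [e2, e, Measure.map_apply (by fun_prop) measurableSet_Iic]
  change (μ.prod (P.map η)) {p : ℝ × ℝ | p.1 + p.2 ≤ z} = _
  rw [Measure.prod_apply_symm hs]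
  simp only [hpre]

lemma abs_real_map_add_Iic_sub_le [IsProbabilityMeasure P] {a b : ℝ} (hb : 0 < b)
    (hZ' : HasLaw Z' (alMeasure 0 a b) P)
    (hη : AEMeasurable η P) (hindep : IndepFun Z' η P) (z : ℝ) :
    |(P.map (fun ω => Z' ω + η ω)).real (Set.Iic z) - (alMeasure 0 a b).real (Set.Iic z)| ≤
      ∫ ω, min 1 ((√(2 * b ^ 2 + a ^ 2))⁻¹ * |η ω|) ∂P := by
  obtain ⟨hint, e⟩ := real_map_add_Iic hZ' hη hindep z
  have e2 : (alMeasure 0 a b).real (Set.Iic z) =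
      ∫ _, (alMeasure 0 a b).real (Set.Iic z) ∂P := by simp
  have hS := sqrt_two_mul_sq_add_sq_pos a hb
  rw [e, e2, ← integral_sub hint (integrable_const _), ← Real.norm_eq_abs]
  refine norm_integral_le_of_norm_le ?_ (Filter.Eventually.of_forall fun ω => ?_)
  · refine Integrable.of_bound (by fun_prop) 1 (Filter.Eventually.of_forall fun ω => ?_)
    rw [Real.norm_eq_abs, abs_of_nonneg (by positivity)]
    exact min_le_left _ _
  · simpa using abs_real_alMeasure_Iic_sub_le a hb (z - η ω) z

lemma integral_min_one_mul_abs_le (k : ℝ) (hk : 0 ≤ k) (hη : Integrable η P) :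
    ∫ ω, min 1 (k * |η ω|) ∂P ≤ k * ∫ ω, |η ω| ∂P := by
  rw [← integral_const_mul]
  refine integral_mono_of_nonneg (Filter.Eventually.of_forall fun ω => ?_)
    (hη.abs.const_mul k) (Filter.Eventually.of_forall fun ω => min_le_right _ _)
  dsimp only
  positivity

/-- Split at |η| = ε, using 1 above the level and kε below it. -/
lemma integral_min_one_mul_abs_le_add [IsProbabilityMeasure P] {k : ℝ} (hk : 0 ≤ k)
    (hη : AEMeasurable η P) {ε : ℝ}
    (hε : 0 ≤ ε) :
    ∫ ω, min 1 (k * |η ω|) ∂P ≤ P.real {ω | ε < |η ω|} + k * ε := by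
  have hA : NullMeasurableSet {ω | ε < |η ω|} P :=
    nullMeasurableSet_lt aemeasurable_const (by fun_prop)
  have hi : Integrable ({ω | ε < |η ω|}.indicator fun _ => (1 : ℝ)) P :=
    (integrable_const 1).indicator₀ hA
  calc _ ≤ ∫ ω, ({ω | ε < |η ω|}.indicator (fun _ => (1 : ℝ)) ω + k * ε) ∂P := by
        refine integral_mono_of_nonneg (Filter.Eventually.of_forall fun ω => by positivity)
          (hi.add (integrable_const _)) (Filter.Eventually.of_forall fun ω => ?_)
        dsimp only
        by_cases h : ε < |η ω|
        · rw [Set.indicator_of_mem (by exact h)]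
          exact (min_le_left _ _).trans (by linarith [mul_nonneg hk hε])
        · rw [Set.indicator_of_notMem (by exact h), zero_add]
          exact (min_le_right _ _).trans (by gcongr; exact not_lt.1 h)
    _ = _ := by
      rw [integral_add hi (integrable_const _), integral_indicator₀ hA]
      simp

lemma integral_abs_le_of_variance_eq [IsProbabilityMeasure P] {τ : ℝ} (hτ : 0 ≤ τ)
    (hη : MemLp η 2 P)
    (hmean : ∫ ω, η ω ∂P = 0) (hvar : variance η P = τ ^ 2) : ∫ ω, |η ω| ∂P ≤ τ := by
  -- Var|η| ≥ 0 gives (E|η|)² ≤ E η² = τ².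
  have h1 := variance_nonneg |η| P
  rw [variance_eq_sub hη.abs] at h1
  rw [variance_eq_sub hη, hmean] at hvar
  simp only [Pi.pow_apply, Pi.abs_apply, sq_abs] at h1 hvar
  refine abs_le_of_sq_le_sq' (by linarith) hτ |>.2

/-- The pair (Z'+η, Z') is itself a coupling, so independence plays no role. -/
lemma abs_integral_map_add_sub_le {μ : Measure ℝ} (hZ' : HasLaw Z' μ P) (hη : Integrable η P)
    {g : ℝ → ℝ} (hg : LipschitzWith 1 g) (hgμ : Integrable g μ) :
    |∫ x, g x ∂(P.map fun ω => Z' ω + η ω) - ∫ x, g x ∂μ| ≤ ∫ ω, |η ω| ∂P := by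
  have hc := hg.continuous
  have hm := hZ'.aemeasurable
  have hmη := hη.aemeasurable
  have lip : ∀ ω, ‖g (Z' ω + η ω) - g (Z' ω)‖ ≤ |η ω| := fun ω => by
    simpa [Real.dist_eq] using hg.dist_le_mul (Z' ω + η ω) (Z' ω)
  rw [← hZ'.map_eq] at hgμ
  have i₁ : Integrable (fun ω => g (Z' ω)) P := hgμ.comp_aemeasurable hm
  have i₂ : Integrable (fun ω => g (Z' ω + η ω) - g (Z' ω)) P :=
    hη.abs.mono' (by
      have : AEMeasurable (fun ω => g (Z' ω + η ω) - g (Z' ω)) P :=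
        (hc.measurable.comp_aemeasurable (hm.add hmη)).sub (hc.measurable.comp_aemeasurable hm)
      exact this.aestronglyMeasurable) (Filter.Eventually.of_forall lip)
  have i₃ : Integrable (fun ω => g (Z' ω + η ω)) P := 
    (i₂.add i₁).congr (Filter.Eventually.of_forall fun ω => by simp)
  rw [← hZ'.map_eq, integral_map (φ := fun ω => Z' ω + η ω) (hm.add hmη) hc.aestronglyMeasurable,
    integral_map hm hc.aestronglyMeasurable, ← integral_sub i₃ i₁, ← Real.norm_eq_abs]
  exact norm_integral_le_of_norm_le hη.abs (Filter.Eventually.of_forall lip)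

lemma dW_map_add_alMeasure_le {a b τ e : ℝ} (hb : 0 < b)
    (hZ' : HasLaw Z' (alMeasure 0 a b) P) (hη : Integrable η P) (he : ∫ ω, |η ω| ∂P ≤ e) :
    dW (P.map fun ω => Z' ω + η ω) (alMeasure 0 a (√(b ^ 2 + τ ^ 2))) ≤
      ENNReal.ofReal (e + τ ^ 2 / √(2 * b ^ 2 + a ^ 2)) := by
  refine dW_le_ofReal fun g hg => ?_
  have h : b ≤ √(b ^ 2 + τ ^ 2) := Real.le_sqrt_of_sq_le (by nlinarith [sq_nonneg τ])
  refine (abs_sub_le _ (∫ x, g x ∂alMeasure 0 a b) _).trans (add_le_add ?_ ?_)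
  · exact (abs_integral_map_add_sub_le hZ' hη hg
      (integrable_alMeasure_of_lipschitz a hb hg)).trans he
  · exact (abs_integral_alMeasure_sub_le a hb h hg).trans (sqrt_two_mul_sq_add_sq_sub_le a hb)

end Perturbation

/-- The exact value of E|η|, replacing τ in the Gaussian Wasserstein bound. -/
lemma integral_abs_gaussianReal_zero (v : ℝ≥0) (hv : v ≠ 0) :
    ∫ x, |x| ∂gaussianReal 0 v = √(2 / Real.pi) * √v := by
  have hv0 : (0 : ℝ) < v := by positivity
  rw [integral_gaussianReal_eq_integral_smul hv]
  have e : ∀ x : ℝ, gaussianPDFReal 0 v x • |x| =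
      (fun y => (√(2 * Real.pi * v))⁻¹ * (y * Real.exp (-(2 * (v : ℝ))⁻¹ * y ^ 2))) |x| := by
    intro x
    simp only [gaussianPDFReal, sub_zero, smul_eq_mul, sq_abs]
    rw [show -x ^ 2 / (2 * (v : ℝ)) = -(2 * (v : ℝ))⁻¹ * x ^ 2 by ring]
    ring
  simp only [e]
  rw [integral_comp_abs (f := fun y => (√(2 * Real.pi * v))⁻¹ *
    (y * Real.exp (-(2 * (v : ℝ))⁻¹ * y ^ 2))), integral_const_mul]
  have h : ∫ y in Set.Ioi (0 : ℝ), y * Real.exp (-(2 * (v : ℝ))⁻¹ * y ^ 2) =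
      (2 * (2 * (v : ℝ))⁻¹)⁻¹ := by
    have := integral_mul_cexp_neg_mul_sq (b := (((2 * (v : ℝ))⁻¹ : ℝ) : ℂ))
      (by rw [Complex.ofReal_re]; positivity)
    rw [← Complex.ofReal_inj, ← integral_complex_ofReal]
    push_cast at this ⊢
    exact this
  rw [h, show 2 / Real.pi = 2 ^ 2 / (2 * Real.pi) by ring, Real.sqrt_div (by positivity),
    Real.sqrt_sq (by norm_num), Real.sqrt_mul (by positivity)]
  have hs := Real.mul_self_sqrt hv0.le
  have hpi : 0 < √(2 * Real.pi) := by positivity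
  have hsv : 0 < √(v : ℝ) := by positivity
  field_simp
  nlinarith

/-! ### Small perturbations and comparison of constants -/

lemma integral_min_one_le_one {Ω : Type*} [MeasurableSpace Ω] {P : Measure Ω}
    [IsProbabilityMeasure P] {f : Ω → ℝ} (hf : ∀ ω, 0 ≤ f ω) : ∫ ω, min 1 (f ω) ∂P ≤ 1 := by
  calc _ ≤ ∫ _, (1 : ℝ) ∂P :=
        integral_mono_of_nonneg (Filter.Eventually.of_forall fun ω => le_min zero_le_one (hf ω))
          (integrable_const _) (Filter.Eventually.of_forall fun ω => min_le_left _ _)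
    _ = 1 := by simp

/-- The Kolmogorov bound only has to be checked for small perturbations, as
`d * τ ^ 2 / (b ^ 2 + τ ^ 2)` is at least one otherwise. -/
lemma dK_map_add_alMeasure_le {Ω : Type*} [MeasurableSpace Ω] {P : Measure Ω}
    [IsProbabilityMeasure P] {Z' η : Ω → ℝ} {a b τ d r : ℝ} (hb : 0 < b)
    (hZ' : HasLaw Z' (alMeasure 0 a b) P) (hη : AEMeasurable η P) (hindep : IndepFun Z' η P)
    (hd : 5 ≤ d) (hr : 0 ≤ r)
    (h : 4 * τ ^ 2 < b ^ 2 → ∫ ω, min 1 ((√(2 * b ^ 2 + a ^ 2))⁻¹ * |η ω|) ∂P ≤ r) :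
    dK (P.map fun ω => Z' ω + η ω) (alMeasure 0 a (√(b ^ 2 + τ ^ 2))) ≤
      ENNReal.ofReal (r + d * τ ^ 2 / (b ^ 2 + τ ^ 2)) := by
  have hB : 0 < b ^ 2 + τ ^ 2 := by positivity
  have hB' : 0 < √(b ^ 2 + τ ^ 2) := Real.sqrt_pos.2 hB
  refine dK_le_ofReal fun z => ?_
  by_cases hτ : 4 * τ ^ 2 < b ^ 2
  · refine (abs_sub_le _ ((alMeasure 0 a b).real (Set.Iic z)) _).trans (add_le_add ?_ ?_)
    · exact (abs_real_map_add_Iic_sub_le hb hZ' hη hindep z).trans (h hτ)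
    · refine (abs_real_alMeasure_sub_sqrt_le a hb measurableSet_Iic).trans ?_
      gcongr
      exact le_mul_of_one_le_left (sq_nonneg τ) (by linarith)
  · have := isProbabilityMeasure_alMeasure a hB'
    have : IsProbabilityMeasure (P.map fun ω => Z' ω + η ω) :=
      Measure.isProbabilityMeasure_map (hZ'.aemeasurable.add hη)
    refine (abs_measureReal_sub_measureReal_le_one _ _ _ _).trans ?_
    -- Here 5τ² ≥ b²+τ², which is where d ≥ 5 enters.
    have : 1 ≤ d * τ ^ 2 / (b ^ 2 + τ ^ 2) := by
      rw [le_div_iff₀ hB]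
      nlinarith [sq_nonneg τ]
    linarith

lemma four_le_sq_mul_div {b τ d : ℝ} (hb : 0 < b) (hτ : 4 * τ ^ 2 < b ^ 2) (hd : 5 ≤ d) :
    4 ≤ b ^ 2 * d / (b ^ 2 + τ ^ 2) := by
  have hB : 0 < b ^ 2 + τ ^ 2 := by positivity
  rw [le_div_iff₀ hB]
  nlinarith [sq_nonneg b]

/-- For small τ the radicand grows by 2τ² < b²/2, hence by a factor of at most 5/4 < (14/12)². -/
lemma twelve_mul_inv_sqrt_le (a : ℝ) {b τ : ℝ} (hb : 0 < b) (hτ : 4 * τ ^ 2 < b ^ 2) :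
    12 * (√(2 * b ^ 2 + a ^ 2))⁻¹ ≤
      14 / √(a ^ 2 + 2 * b ^ 2 + 2 * τ ^ 2) + 7 * |a| / (b ^ 2 + τ ^ 2) := by
  have hS := sqrt_two_mul_sq_add_sq_pos a hb
  have hT : 0 < √(a ^ 2 + 2 * b ^ 2 + 2 * τ ^ 2) := by positivity
  have h : √(a ^ 2 + 2 * b ^ 2 + 2 * τ ^ 2) ≤ 14 / 12 * √(2 * b ^ 2 + a ^ 2) := by
    apply Real.sqrt_le_iff.2 ⟨by positivity, ?_⟩
    rw [mul_pow, sq_sqrt_two_mul_sq_add_sq]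
    nlinarith [sq_nonneg a]
  have : 12 * (√(2 * b ^ 2 + a ^ 2))⁻¹ ≤ 14 / √(a ^ 2 + 2 * b ^ 2 + 2 * τ ^ 2) := by
    rw [← div_eq_mul_inv, div_le_div_iff₀ hS hT]
    linarith
  have : 0 ≤ 7 * |a| / (b ^ 2 + τ ^ 2) := by positivity
  linarith

/-- As kτ ≤ 1, its cube is at most its square, so the linear bound implies the one of order τ^{2/3}.
-/
lemma le_rpow_third_of_twelve_mul_le {K k c τ : ℝ} (hK : 4 ≤ K) (hk : 0 ≤ k) (hτ : 0 ≤ τ)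
    (hc : 12 * k ≤ c) (h1 : k * τ ≤ 1) : k * τ ≤ (K * (c * τ) ^ 2) ^ (1 / 3 : ℝ) := by
  have hkτ : 0 ≤ k * τ := by positivity
  rw [one_div, Real.le_rpow_inv_iff_of_pos hkτ (by positivity) (by norm_num)]
  have h12 : 12 * (k * τ) ≤ c * τ := by nlinarith
  have h3 : (k * τ) ^ (3 : ℝ) = (k * τ) ^ 3 := by exact_mod_cast Real.rpow_natCast (k * τ) 3
  rw [h3]
  calc (k * τ) ^ 3 ≤ (k * τ) ^ 2 := pow_le_pow_of_le_one hkτ h1 (by norm_num)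
    _ ≤ (c * τ) ^ 2 := by gcongr; linarith
    _ ≤ K * (c * τ) ^ 2 := le_mul_of_one_le_left (sq_nonneg _) (by linarith)

/-- Bernoulli's inequality with exponent n/2 ≥ 1, then squared so as to beat a quadratic polynomial.
-/
lemma sq_add_three_mul_add_two_le_eight_mul_rpow {n : ℝ} (hn : 2 ≤ n) :
    n ^ 2 + 3 * n + 2 ≤ 8 * 12 ^ n := by
  have h := one_add_mul_self_le_rpow_one_add (s := 11) (by norm_num) (p := n / 2) (by linarith)
  have e : (12 : ℝ) ^ n = ((1 + 11 : ℝ) ^ (n / 2)) ^ 2 := by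
    rw [← Real.rpow_natCast, ← Real.rpow_mul (by norm_num)]
    norm_num
  rw [e]
  nlinarith

/-- Optimization of the cut-off level for tails of polynomial decay. -/
lemma integral_min_one_le_of_tail_le {Ω : Type*} [MeasurableSpace Ω] {P : Measure Ω}
    [IsProbabilityMeasure P] {η : Ω → ℝ} (hη : AEMeasurable η P) {k T n X : ℝ} (hk : 0 < k)
    (hX : 0 < X) (hn : 0 < n) (htail : ∀ s, 0 < s → P.real {ω | s < |η ω|} ≤ T / s ^ n)
    (h : T * k ^ n ≤ X) : ∫ ω, min 1 (k * |η ω|) ∂P ≤ 2 * X ^ (1 / (n + 1)) := by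
  set ρ := X ^ (1 / (n + 1)) with hρ
  have hρ0 : 0 < ρ := by positivity
  have hρX : ρ ^ n * ρ = X := by
    rw [← Real.rpow_add_one hρ0.ne', hρ, ← Real.rpow_mul hX.le, one_div,
      inv_mul_cancel₀ (by positivity), Real.rpow_one]
  -- The cut-off ε = ρ/k makes kε = ρ, and ρ^{n+1} = X makes the tail at most ρ too.
  have hε : 0 < ρ / k := by positivity
  refine (integral_min_one_mul_abs_le_add hk.le hη hε.le).trans ?_
  have h1 : P.real {ω | ρ / k < |η ω|} ≤ ρ := by
    refine (htail _ hε).trans ?_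
    rw [div_le_iff₀ (by positivity), Real.div_rpow hρ0.le hk.le, ← mul_div_assoc,
      le_div_iff₀ (by positivity), mul_comm ρ, hρX]
    exact h
  rw [mul_div_cancel₀ _ hk.ne']
  linarith

/-- With L = log(1/τ): if √L ≥ 1/24, the term 2cτ√L is at least kτ because c ≥ 12k. Otherwise τ ≥
1-L is close to 1 and the term with √L in the denominator exceeds 1. -/
lemma log_factor_lower_bound {K k c τ : ℝ} (hK : 4 ≤ K) (hk : 0 ≤ k) (hc : 12 * k ≤ c)
    (hτ : 0 < τ) (hτ1 : τ < 1) :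
    min 1 (k * τ) ≤
      (2 * c + K / (2 * √(2 * Real.pi) * Real.log (1 / τ))) * τ * √(Real.log (1 / τ)) := by
  have hL : 0 < Real.log (1 / τ) := Real.log_pos (by rw [lt_div_iff₀ hτ]; linarith)
  have hL1 : 1 - Real.log (1 / τ) ≤ τ := by
    rw [one_div, Real.log_inv]
    linarith [Real.log_le_sub_one_of_pos hτ]
  set L := Real.log (1 / τ)
  have hs : 0 < √L := by positivity
  have hsL : √L * √L = L := Real.mul_self_sqrt hL.le
  have hpi : √(2 * Real.pi) ≤ 3 := by
    apply Real.sqrt_le_iff.2 ⟨by norm_num, ?_⟩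
    nlinarith [Real.pi_le_four, Real.pi_lt_d2]
  have hpi0 : 0 < √(2 * Real.pi) := by positivity
  have hc0 : 0 ≤ c := by linarith
  have e : (2 * c + K / (2 * √(2 * Real.pi) * L)) * τ * √L =
      2 * c * τ * √L + K * τ / (2 * √(2 * Real.pi) * √L) := by
    have : ∀ s : ℝ, 0 < s → (2 * c + K / (2 * √(2 * Real.pi) * (s * s))) * τ * s =
        2 * c * τ * s + K * τ / (2 * √(2 * Real.pi) * s) := fun s hs => by field_simp
    simpa only [hsL] using this √L hs
  rw [e]
  rcases le_or_gt (1 / 24) √L with h | h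
  · refine (min_le_right _ _).trans ?_
    have h1 : 0 ≤ K * τ / (2 * √(2 * Real.pi) * √L) := by positivity
    have h2 : 2 * c * τ * (1 / 24) ≤ 2 * c * τ * √L := by gcongr
    nlinarith
  · refine (min_le_left _ _).trans ?_
    have h1 : 0 ≤ 2 * c * τ * √L := by positivity
    have h2 : 1 ≤ K * τ / (2 * √(2 * Real.pi) * √L) := by
      rw [le_div_iff₀ (by positivity)]
      have h3 : √(2 * Real.pi) * √L ≤ 3 * (1 / 24) := by gcongr
      have h4 : L ≤ 1 / 24 * (1 / 24) := by rw [← hsL]; gcongr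
      nlinarith
    linarith

/-! ### The theorem -/

theorem theorem4p2 {Ω : Type*} [MeasurableSpace Ω] (P : Measure Ω) [IsProbabilityMeasure P]
    (a b τ : ℝ) (hb : 0 < b) (hτ : 0 ≤ τ)
    (Z' η : Ω → ℝ)
    (hZ' : HasLaw Z' (alMeasure 0 a b) P)
    (hη : MemLp η 2 P) (hmean : ∫ ω, η ω ∂P = 0) (hvar : variance η P = τ ^ 2)
    (hindep : IndepFun Z' η P)
    (W : Ω → ℝ) (hW : W = fun ω => Z' ω + η ω)
    (c d : ℝ)
    (hc : c = 14 / √(a ^ 2 + 2 * b ^ 2 + 2 * τ ^ 2) + 7 * |a| / (b ^ 2 + τ ^ 2))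
    (hd : d = 5 + 7 * |a| / √(a ^ 2 + 2 * b ^ 2 + 2 * τ ^ 2)) :
    (dK (P.map W) (alMeasure 0 a (√(b ^ 2 + τ ^ 2))) ≤
        ENNReal.ofReal
          (1.05 * (b ^ 2 * c ^ 2 * d * τ ^ 2 / (b ^ 2 + τ ^ 2)) ^ (1 / 3 : ℝ)
            + d * τ ^ 2 / (b ^ 2 + τ ^ 2)) ∧
      dW (P.map W) (alMeasure 0 a (√(b ^ 2 + τ ^ 2))) ≤
        ENNReal.ofReal (τ + τ ^ 2 / √(2 * b ^ 2 + a ^ 2))) ∧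
    (∀ n C : ℝ, 2 ≤ n → 0 < C →
      (∀ s : ℝ, 0 < s → P.real {ω | s < |η ω|} ≤ C * τ ^ n / s ^ n) →
      dK (P.map W) (alMeasure 0 a (√(b ^ 2 + τ ^ 2))) ≤
        ENNReal.ofReal
          (2 * (2 * b ^ 2 * c ^ n * C * d * τ ^ n /
              ((b ^ 2 + τ ^ 2) * (n ^ 2 + 3 * n + 2))) ^ (1 / (n + 1))
            + d * τ ^ 2 / (b ^ 2 + τ ^ 2))) ∧
    (0 < τ → τ < 1 → HasLaw η (gaussianReal 0 (Real.toNNReal (τ ^ 2))) P →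
      dK (P.map W) (alMeasure 0 a (√(b ^ 2 + τ ^ 2))) ≤
        ENNReal.ofReal
          ((2 * c + b ^ 2 * d / (2 * √(2 * Real.pi) * (b ^ 2 + τ ^ 2) * Real.log (1 / τ)))
              * τ * √(Real.log (1 / τ))
            + d * τ ^ 2 / (b ^ 2 + τ ^ 2)) ∧
      dW (P.map W) (alMeasure 0 a (√(b ^ 2 + τ ^ 2))) ≤
        ENNReal.ofReal (√(2 / Real.pi) * τ + τ ^ 2 / √(2 * b ^ 2 + a ^ 2))) := by

  subst hW
  have hS := sqrt_two_mul_sq_add_sq_pos a hb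
  have hηm : AEMeasurable η P := hη.aestronglyMeasurable.aemeasurable
  have hηi : Integrable η P := hη.integrable one_le_two
  have hB : 0 < b ^ 2 + τ ^ 2 := by positivity
  have hd5 : 5 ≤ d := by
    rw [hd]
    have : 0 ≤ 7 * |a| / √(a ^ 2 + 2 * b ^ 2 + 2 * τ ^ 2) := by positivity
    linarith
  have hc0 : 0 < c := by rw [hc]; positivity
  have hc12 : 4 * τ ^ 2 < b ^ 2 → 12 * (√(2 * b ^ 2 + a ^ 2))⁻¹ ≤ c := fun h =>
    hc ▸ twelve_mul_inv_sqrt_le a hb h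
  have hK : 4 * τ ^ 2 < b ^ 2 → 4 ≤ b ^ 2 * d / (b ^ 2 + τ ^ 2) := fun h =>
    four_le_sq_mul_div hb h hd5
  have hk : 0 < (√(2 * b ^ 2 + a ^ 2))⁻¹ := inv_pos.2 hS
  have habs := integral_abs_le_of_variance_eq hτ hη hmean hvar
  have hmin : ∫ ω, min 1 ((√(2 * b ^ 2 + a ^ 2))⁻¹ * |η ω|) ∂P ≤
      (√(2 * b ^ 2 + a ^ 2))⁻¹ * τ :=
    (integral_min_one_mul_abs_le _ hk.le hηi).trans (by gcongr)
  have hmin1 : ∫ ω, min 1 ((√(2 * b ^ 2 + a ^ 2))⁻¹ * |η ω|) ∂P ≤ 1 :=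
    integral_min_one_le_one fun ω => by positivity
  refine ⟨⟨?_, dW_map_add_alMeasure_le hb hZ' hηi habs⟩, ?_, ?_⟩
  · refine dK_map_add_alMeasure_le hb hZ' hηm hindep hd5 (by positivity) fun h => ?_
    have h1 : (√(2 * b ^ 2 + a ^ 2))⁻¹ * τ ≤ 1 := by
      rw [inv_mul_le_iff₀ hS, mul_one]
      apply Real.le_sqrt_of_sq_le
      nlinarith [sq_nonneg a, sq_nonneg τ]
    have h2 := le_rpow_third_of_twelve_mul_le (hK h) hk.le hτ (hc12 h) h1
    rw [show b ^ 2 * c ^ 2 * d * τ ^ 2 / (b ^ 2 + τ ^ 2) =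
      b ^ 2 * d / (b ^ 2 + τ ^ 2) * (c * τ) ^ 2 by ring]
    refine (hmin.trans h2).trans (le_mul_of_one_le_left (by positivity) (by norm_num))
  · intro n C hn hC htail
    have hn0 : 0 < n ^ 2 + 3 * n + 2 := by positivity
    refine dK_map_add_alMeasure_le hb hZ' hηm hindep hd5 (by positivity) fun h => ?_
    -- For τ = 0 the optimal cut-off would be 0, which the tail hypothesis excludes; there E|η| ≤ 0
    -- suffices.
    rcases hτ.eq_or_lt with rfl | hτ0
    · exact hmin.trans (by rw [mul_zero]; positivity)
    refine integral_min_one_le_of_tail_le hηm hk (by positivity) (by linarith) htail ?_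
    have h12 : 12 ^ n * (√(2 * b ^ 2 + a ^ 2))⁻¹ ^ n ≤ c ^ n := by
      rw [← Real.mul_rpow (by norm_num) hk.le]
      exact Real.rpow_le_rpow (by positivity) (hc12 h) (by linarith)
    have hp := sq_add_three_mul_add_two_le_eight_mul_rpow hn
    have hkn : 0 < (√(2 * b ^ 2 + a ^ 2))⁻¹ ^ n := Real.rpow_pos_of_pos hk n
    -- The factor 8 = 2·4 is the explicit 2 of the bound times the lower bound 4 for b²d/(b²+τ²),
    -- and 12ⁿ is absorbed by cⁿ.
    have h3 : (√(2 * b ^ 2 + a ^ 2))⁻¹ ^ n * (n ^ 2 + 3 * n + 2) ≤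
        2 * (b ^ 2 * d / (b ^ 2 + τ ^ 2)) * c ^ n :=
      calc _ ≤ (√(2 * b ^ 2 + a ^ 2))⁻¹ ^ n * (8 * 12 ^ n) := by gcongr
        _ = 2 * 4 * (12 ^ n * (√(2 * b ^ 2 + a ^ 2))⁻¹ ^ n) := by ring
        _ ≤ _ := by gcongr; exact hK h
    rw [show 2 * b ^ 2 * c ^ n * C * d * τ ^ n / ((b ^ 2 + τ ^ 2) * (n ^ 2 + 3 * n + 2)) =
      C * τ ^ n * (2 * (b ^ 2 * d / (b ^ 2 + τ ^ 2)) * c ^ n / (n ^ 2 + 3 * n + 2)) by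
        field_simp]
    gcongr
    rwa [le_div_iff₀ hn0]
  · intro hτ0 hτ1 hgauss
    constructor
    · have hL : 0 < Real.log (1 / τ) := Real.log_pos (by rw [lt_div_iff₀ hτ0]; linarith)
      refine dK_map_add_alMeasure_le hb hZ' hηm hindep hd5 (by positivity) fun h => ?_
      have h1 := log_factor_lower_bound (hK h) hk.le (hc12 h) hτ0 hτ1
      rw [show b ^ 2 * d / (2 * √(2 * Real.pi) * (b ^ 2 + τ ^ 2) * Real.log (1 / τ)) =
        b ^ 2 * d / (b ^ 2 + τ ^ 2) / (2 * √(2 * Real.pi) * Real.log (1 / τ)) by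
          field_simp]
      exact (le_min hmin1 hmin).trans h1
    · refine dW_map_add_alMeasure_le hb hZ' hηi (le_of_eq ?_)
      have hv : Real.toNNReal (τ ^ 2) ≠ 0 := by
        rw [Ne, Real.toNNReal_eq_zero, not_le]
        positivity
      have e := integral_abs_gaussianReal_zero _ hv
      rw [Real.coe_toNNReal _ (sq_nonneg τ), Real.sqrt_sq hτ] at e
      rw [← e, ← hgauss.map_eq, integral_map hηm continuous_abs.aestronglyMeasurable]
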